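/- Define the Rudin--Shapiro polynomials by $P_0(z)=Q_0(z)=1$ and, for $k\ge 0$, $P_{k+1}(z)=P_k(z)+z^{2^k}Q_k(z)$ and $Q_{k+1}(z)=P_k(z)-z^{2^k}Q_k(z)$. Let $\omega$ be a random variable uniformly distributed on the unit circle $\{z\in\mathbb{C}:|z|=1\}$, and let $D=\{z\in\mathbb{C}:|z|\le 1\}$. Then $P_k(\omega)/\sqrt{2^{k+1}}$ becomes uniformly distributed in $D$ as $k\to\infty$, in the following sense: for every rectangle $E\subseteq D$ (in any position, with or without its boundary edges), $$\lim_{k\to\infty}\mathbb{P}\Big(\frac{P_k(\omega)}{\sqrt{2^{k+1}}}\in E\Big)=\frac{|E|}{\pi},$$ where $|E|$ denotes the area of $E$. -/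

import Mathlib

open MeasureTheory ProbabilityTheory Filter Topology Polynomial

namespace RudinShapiro

/-- The pair `(P k, Q k)` of Rudin-Shapiro polynomials: `P 0 = Q 0 = 1`,
`P (k+1) = P k + z ^ (2 ^ k) * Q k` and `Q (k+1) = P k - z ^ (2 ^ k) * Q k`. -/
noncomputable def pair : ℕ → ℂ[X] × ℂ[X]
  | 0 => (1, 1)
  | k + 1 => ((pair k).1 + X ^ (2 ^ k) * (pair k).2, (pair k).1 - X ^ (2 ^ k) * (pair k).2)

/-- The Rudin-Shapiro polynomial `P k`. -/
noncomputable def P (k : ℕ) : ℂ[X] := (pair k).1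

/-- The companion Rudin-Shapiro polynomial `Q k`. -/
noncomputable def Q (k : ℕ) : ℂ[X] := (pair k).2

/-- The uniform probability distribution on the unit circle of `ℂ`, as a measure on `ℂ`: the law
of `exp (i θ)` for `θ` uniformly distributed on `(0, 2π]`. -/
noncomputable def circleUniform : Measure ℂ :=
  (volume[|Set.Ioc (0 : ℝ) (2 * Real.pi)]).map (fun θ : ℝ => Complex.exp (θ * Complex.I))

/-- A rectangle in the plane `ℂ`, in any position (not only axis-parallel): the image of a product
`I × J` of two real intervals under the rotation `z ↦ u * z`, `‖u‖ = 1`. (Translations are absorbed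
in `I` and `J`.) The intervals may be open, closed or half-open. -/
def IsRectangle (E : Set ℂ) : Prop :=
  ∃ (u : ℂ) (I J : Set ℝ), ‖u‖ = 1 ∧ I.OrdConnected ∧ J.OrdConnected ∧
    E = (fun z : ℂ => u * z) '' (I ×ℂ J)

end RudinShapiro

/-!
The normalized pair `v_k = (P_k, Q_k) / √(2 ^ (k + 1))` is a unit vector of `ℂ²`, moved by the
unitary cocycle `v_{k+1} = H diag(1, z ^ 2 ^ k) v_k`, where `H = (1, 1; 1, -1) / √2`.
If `v_k` equidistributes on the sphere `S³`, then its first coordinate equidistributes in the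
disc. Only the matrix coefficients of nontrivial irreducible representations of `SU(2)` which
depend on the first coordinate alone are needed: these are the disc polynomials `discPoly j e`,
the coefficient of `s ^ j * t ^ e` in the binary form `(x s + y t) ^ j * (-ȳ s + x̄ t) ^ e`
(`formRS`).

On binary forms of degree `n = j + e`, one step of the cocycle is `krawMatrix n` (the action of
`H`) times a diagonal matrix of powers of `z ^ 2 ^ k`. As squaring preserves the uniform measure
of the circle, the mean of the product of `k` steps is read off from the `k`-th power of one
operator, `transfer n`, on polynomials in `z` of degree at most `n` with values in the forms
(`sum_cocycleCoeff_mul`). So the mean of `discPoly j e` tends to `0` once `transfer n` has no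
eigenvalue `l` with `‖l‖ ≥ 1` (`norm_lt_one_of_transfer_eq_smul`). Suppose it had one, with
eigenvector `Φ`.
* `krawMatrix n` preserves the `SU(2)`-invariant norm (`energy_krawMatrix_mulVec`). Hence
  `transfer n` is a contraction which loses exactly the entries `Φ N m` with `N + m` odd, so
  these vanish, and each row of `Φ` is an even or odd polynomial in `t`.
* By the eigenvalue equation the top row, of index `p`, is divisible by `(1 - t) ^ p`, hence by
  parity also by `(1 + t) ^ p`, so `2 p ≤ n`. Symmetrically, the bottom row, of index `q`,
  satisfies `2 (n - q) ≤ n`. Thus `p = q = n / 2`: there is only one nonzero row.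
* The equation then makes this row a multiple of `t ^ p`, which is not divisible by `1 - t`
  unless it vanishes.

The disc polynomials other than `discPoly 0 0` have mean `0` over the disc as well
(`integral_discPoly`), and modulo lower degree they are nonzero multiples of the monomials
`x ^ j * x̄ ^ e`, so all moments converge (`meanConverges_monomial`). The Stone-Weierstrass theorem on the
closed disc upgrades this to weak convergence (`tendsto_lawP`), and the portmanteau theorem
applies to a rectangle, whose frontier is null because it is convex.
-/

namespace RudinShapiro

/-! ### Krawtchouk matrices and the invariant norm of binary forms -/

theorem aeval_homogenize_eq_sum (n : ℕ) (p U V : ℂ[X]) :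
    MvPolynomial.aeval ![V, U] (p.homogenize n)
      = ∑ m ∈ Finset.range (n + 1), C (p.coeff m) * (U ^ (n - m) * V ^ m) := by
  rw [homogenize, Finset.Nat.sum_antidiagonal_eq_sum_range_succ_mk, map_sum]
  refine Finset.sum_congr rfl fun m _ => ?_
  rw [MvPolynomial.aeval_monomial]
  simp only [Finsupp.prod_fintype, pow_zero, implies_true, Fin.prod_univ_two]
  simp [mul_comm]

theorem homogenize_linear_pow (x y : ℂ) (j : ℕ) (U V : ℂ[X]) :
    MvPolynomial.aeval ![V, U] (((C x + C y * X) ^ j).homogenize j)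
      = (C x * U + C y * V) ^ j := by
  have hd : (C x + C y * X).natDegree ≤ 1 := by compute_degree
  have h := homogenize_finsetProd (s := Finset.range j) (p := fun _ => C x + C y * X)
    (n := fun _ => 1) (fun _ _ => hd)
  simp only [Finset.prod_const, Finset.card_range, Finset.sum_const, smul_eq_mul, mul_one] at h
  rw [h, map_pow, aeval_homogenize_eq_sum]
  simp [Finset.sum_range_succ, coeff_X]

/-- Substituting `(s, t) ↦ (U, V)` in a product of powers of two linear forms, where the binary form
is given through the coefficients of its dehomogenization. -/
theorem sum_coeff_linear_mul_linear (x y a b : ℂ) (j e : ℕ) (U V : ℂ[X]) :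
    ∑ m ∈ Finset.range (j + e + 1),
        C (((C x + C y * X) ^ j * (C a + C b * X) ^ e).coeff m) * (U ^ (j + e - m) * V ^ m)
      = (C x * U + C y * V) ^ j * (C a * U + C b * V) ^ e := by
  have hd : ∀ (x y : ℂ) (j : ℕ), ((C x + C y * X) ^ j).natDegree ≤ j := fun x y j => by
    have : (C x + C y * X).natDegree ≤ 1 := by compute_degree
    simpa using natDegree_pow_le_of_le j this
  rw [← aeval_homogenize_eq_sum, homogenize_mul _ _ (hd _ _ _) (hd _ _ _), map_mul,
    homogenize_linear_pow, homogenize_linear_pow]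

/-- The generating polynomial `(1 + X) ^ (n - m) * (1 - X) ^ m` of the Krawtchouk numbers. -/
noncomputable def kraw (n m : ℕ) : ℂ[X] := (1 + X) ^ (n - m) * (1 - X) ^ m

/-- The action of the Hadamard matrix `(1, 1; 1, -1) / √2` on binary forms of degree `n`, in the
basis `s ^ (n - m) * t ^ m`. -/
noncomputable def krawMatrix (n : ℕ) : Matrix (Fin (n + 1)) (Fin (n + 1)) ℂ :=
  Matrix.of fun i m => ((Real.sqrt 2 : ℂ) ^ n)⁻¹ * (kraw n m).coeff i

theorem natDegree_kraw_le {n m : ℕ} (h : m ≤ n) : (kraw n m).natDegree ≤ n := by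
  have h1 : ((1 + X : ℂ[X]) ^ (n - m)).natDegree ≤ n - m := by
    have : (1 + X : ℂ[X]).natDegree ≤ 1 := by compute_degree
    simpa using natDegree_pow_le_of_le (n - m) this
  have h2 : ((1 - X : ℂ[X]) ^ m).natDegree ≤ m := by
    have : (1 - X : ℂ[X]).natDegree ≤ 1 := by compute_degree
    simpa using natDegree_pow_le_of_le m this
  exact (natDegree_mul_le_of_le h1 h2).trans (by omega)

/-- The Hadamard substitution `(s, t) ↦ (s + t, s - t)`, applied twice, is multiplication by `2`. -/
theorem sum_coeff_kraw_mul_kraw {n i : ℕ} (hi : i ≤ n) :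
    ∑ m ∈ Finset.range (n + 1), C ((kraw n i).coeff m) * kraw n m = C (2 ^ n) * X ^ i := by
  have h := sum_coeff_linear_mul_linear 1 1 1 (-1) (n - i) i (1 + X) (1 - X)
  rw [Nat.sub_add_cancel hi] at h
  have h1 : (C 1 + C 1 * X : ℂ[X]) ^ (n - i) * (C 1 + C (-1) * X) ^ i = kraw n i := by
    simp [kraw, sub_eq_add_neg]
  rw [h1] at h
  simp only [kraw] at h ⊢
  rw [h]
  have h2 : (C 1 * (1 + X) + C 1 * (1 - X) : ℂ[X]) = C 2 := by
    simp only [map_one, map_ofNat]; ring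
  have h3 : (C 1 * (1 + X) + C (-1) * (1 - X) : ℂ[X]) = C 2 * X := by
    simp only [map_one, map_neg, map_ofNat]; ring
  rw [h2, h3, mul_pow, ← mul_assoc, ← pow_add, Nat.sub_add_cancel hi, ← C_pow]

theorem sqrt_two_pow_mul_self (n : ℕ) :
    (Real.sqrt 2 : ℂ) ^ n * (Real.sqrt 2 : ℂ) ^ n = 2 ^ n := by
  rw [← mul_pow, ← Complex.ofReal_mul, Real.mul_self_sqrt (by norm_num)]; norm_num

theorem krawMatrix_mul_self (n : ℕ) : krawMatrix n * krawMatrix n = 1 := by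
  ext a i
  have h := congrArg (fun p => p.coeff (a : ℕ)) (sum_coeff_kraw_mul_kraw (Nat.le_of_lt_succ i.2))
  simp only [finsetSum_coeff, coeff_C_mul, coeff_X_pow] at h
  rw [Finset.sum_range] at h
  rw [Matrix.mul_apply, Matrix.one_apply]
  simp only [krawMatrix, Matrix.of_apply]
  have h2 : ∀ x : Fin (n + 1), ((Real.sqrt 2 : ℂ) ^ n)⁻¹ * (kraw n x).coeff a *
      (((Real.sqrt 2 : ℂ) ^ n)⁻¹ * (kraw n i).coeff x) =
      ((2 : ℂ) ^ n)⁻¹ * ((kraw n i).coeff x * (kraw n x).coeff a) := fun x => by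
    rw [← sqrt_two_pow_mul_self, mul_inv]; ring
  simp only [h2]
  rw [← Finset.mul_sum, h]
  simp [Fin.ext_iff]

/-- Self-adjointness of the Hadamard substitution for the invariant inner product. -/
theorem choose_mul_coeff_kraw {n i m : ℕ} (hi : i ≤ n) (hm : m ≤ n) :
    (n.choose m : ℂ) * (kraw n m).coeff i = n.choose i * (kraw n i).coeff m := by
  -- Both sides are the coefficient of `X ^ i * Y ^ m` in `((1 + X) + (1 - X) * Y) ^ n`.
  have key : (C (1 + X) + C (1 - X) * X : ℂ[X][X]) ^ n
      = ((1 - X) * C X + (1 + X)) ^ n := by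
    congr 1; simp only [map_add, map_sub, map_one]; ring
  have hL : (((C (1 + X) + C (1 - X) * X : ℂ[X][X]) ^ n).coeff m).coeff i
      = (n.choose m : ℂ) * (kraw n m).coeff i := by
    rw [add_comm, add_pow]
    have : ∀ a, (C (1 - X) * X : ℂ[X][X]) ^ a * C (1 + X) ^ (n - a) * (n.choose a : ℂ[X][X])
        = C (C (n.choose a : ℂ) * kraw n a) * X ^ a := fun a => by
      simp only [kraw, map_mul, map_pow, map_natCast]; ring
    simp only [this, finsetSum_coeff, coeff_C_mul, coeff_X_pow, mul_ite, mul_one, mul_zero]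
    simp only [apply_ite (fun p : ℂ[X] => p.coeff i), coeff_zero]
    rw [Finset.sum_ite_eq]
    simp [Nat.lt_succ_of_le hm]
  have hR : ((((1 - X) * C X + (1 + X) : ℂ[X][X]) ^ n).coeff m).coeff i
      = n.choose i * (kraw n i).coeff m := by
    rw [add_pow]
    have : ∀ a, ((1 - X) * C X : ℂ[X][X]) ^ a * (1 + X) ^ (n - a) * (n.choose a : ℂ[X][X])
        = C (X ^ a) * (C (n.choose a : ℂ) * kraw n a).map C := fun a => by
      simp [kraw, mul_pow]; ring
    simp only [this, finsetSum_coeff, coeff_C_mul, coeff_map]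
    simp only [mul_comm (X ^ _), coeff_C_mul, coeff_X_pow, mul_ite, mul_one, mul_zero]
    rw [Finset.sum_ite_eq]
    simp [Nat.lt_succ_of_le hi]
  rw [← hL, ← hR, key]

/-- The invariant (Bombieri) norm squared of a binary form of degree `n`. -/
noncomputable def energy (n : ℕ) (c : Fin (n + 1) → ℂ) : ℝ :=
  ∑ m : Fin (n + 1), ‖c m‖ ^ 2 / (n.choose m : ℝ)

theorem energy_krawMatrix_mulVec (n : ℕ) (c : Fin (n + 1) → ℂ) :
    energy n ((krawMatrix n).mulVec c) = energy n c := by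
  set A := krawMatrix n
  have hE : ∀ c : Fin (n + 1) → ℂ,
      (energy n c : ℂ) = ∑ m, c m * (starRingEnd ℂ) (c m) * (n.choose m : ℂ)⁻¹ := fun c => by
    rw [energy, Complex.ofReal_sum]
    refine Finset.sum_congr rfl fun m _ => ?_
    rw [Complex.mul_conj, Complex.normSq_eq_norm_sq]
    push_cast; rfl
  have hch : ∀ m : Fin (n + 1), (n.choose m : ℂ) ≠ 0 := fun m => by
    exact_mod_cast (Nat.choose_pos (Nat.le_of_lt_succ m.2)).ne'
  have hconj : ∀ i m, (starRingEnd ℂ) (A i m) = A i m := fun i m => by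
    have : (kraw n m).coeff i = (((((1 + X) ^ (n - (m : ℕ)) * (1 - X) ^ (m : ℕ) : ℤ[X]).coeff i : ℤ)
        : ℂ)) := by
      have : kraw n m = ((1 + X) ^ (n - (m : ℕ)) * (1 - X) ^ (m : ℕ) : ℤ[X]).map
        (Int.castRingHom ℂ) := by simp [kraw]
      rw [this, coeff_map]; simp
    simp only [A, krawMatrix, Matrix.of_apply, this]
    simp
  have hsym : ∀ i m, A i m * (n.choose i : ℂ)⁻¹ = A m i * (n.choose m : ℂ)⁻¹ := fun i m => by
    have := choose_mul_coeff_kraw (Nat.le_of_lt_succ i.2) (Nat.le_of_lt_succ m.2)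
    simp only [A, krawMatrix, Matrix.of_apply]
    have h1 := hch i
    have h2 := hch m
    field_simp
    linear_combination this
  have hAA : A.mulVec (A.mulVec c) = c := by
    rw [Matrix.mulVec_mulVec, krawMatrix_mul_self, Matrix.one_mulVec]
  apply Complex.ofReal_injective
  rw [hE, hE]
  calc ∑ i, A.mulVec c i * (starRingEnd ℂ) (A.mulVec c i) * (n.choose i : ℂ)⁻¹
      = ∑ i, ∑ m, A.mulVec c i * (starRingEnd ℂ) (c m) * (A m i * (n.choose m : ℂ)⁻¹) := by
        refine Finset.sum_congr rfl fun i _ => ?_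
        rw [show (starRingEnd ℂ) (A.mulVec c i) = ∑ m, A i m * (starRingEnd ℂ) (c m) by
          simp [Matrix.mulVec, dotProduct, hconj]]
        rw [Finset.mul_sum, Finset.sum_mul]
        refine Finset.sum_congr rfl fun m _ => ?_
        rw [← hsym]; ring
    _ = ∑ m, A.mulVec (A.mulVec c) m * (starRingEnd ℂ) (c m) * (n.choose m : ℂ)⁻¹ := by
        rw [Finset.sum_comm]
        refine Finset.sum_congr rfl fun m _ => ?_
        rw [Matrix.mulVec, dotProduct, Finset.sum_mul, Finset.sum_mul]
        exact Finset.sum_congr rfl fun i _ => by ring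
    _ = _ := by rw [hAA]

/-! ### The transfer operator and its eigenvalues -/

/-- The coefficients of the even-frequency part of `∑ N, ∑ m, Φ N m * z ^ (N + m) * t ^ m`, with
`z ^ 2` renamed to `z`. -/
def gather (n : ℕ) (Φ : Fin (n + 1) → Fin (n + 1) → ℂ) (N m : Fin (n + 1)) : ℂ :=
  ∑ N' : Fin (n + 1), if (N' : ℕ) + m = 2 * N then Φ N' m else 0

/-- The transfer operator of the doubling map `z ↦ z ^ 2` twisted by the Rudin-Shapiro cocycle, on
polynomials in `z` of degree at most `n` with values in the binary forms of degree `n`. The array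
entry `Φ N m` is the coefficient of `z ^ N` and of the basis form `s ^ (n - m) * t ^ m`. -/
noncomputable def transfer (n : ℕ) :
    (Fin (n + 1) → Fin (n + 1) → ℂ) →ₗ[ℂ] (Fin (n + 1) → Fin (n + 1) → ℂ) where
  toFun Φ N := (krawMatrix n).mulVec (gather n Φ N)
  map_add' Φ Ψ := by
    funext N
    rw [Pi.add_apply, ← Matrix.mulVec_add]
    congr 1
    funext m
    simp only [gather, Pi.add_apply, ← Finset.sum_add_distrib]
    exact Finset.sum_congr rfl fun _ _ => by split_ifs <;> simp
  map_smul' a Φ := by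
    funext N
    rw [Pi.smul_apply, RingHom.id_apply, ← Matrix.mulVec_smul]
    congr 1
    funext m
    simp only [gather, Pi.smul_apply, Finset.smul_sum]
    exact Finset.sum_congr rfl fun _ _ => by split_ifs <;> simp

theorem transfer_apply (n : ℕ) (Φ : Fin (n + 1) → Fin (n + 1) → ℂ) (N : Fin (n + 1)) :
    transfer n Φ N = (krawMatrix n).mulVec (gather n Φ N) := rfl

theorem norm_gather_sq (n : ℕ) (Φ : Fin (n + 1) → Fin (n + 1) → ℂ) (N m : Fin (n + 1)) :
    ‖gather n Φ N m‖ ^ 2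
      = ∑ N' : Fin (n + 1), if (N' : ℕ) + m = 2 * N then ‖Φ N' m‖ ^ 2 else 0 := by
  by_cases h : ∃ a : Fin (n + 1), (a : ℕ) + m = 2 * N
  · obtain ⟨a, ha⟩ := h
    have hiff : ∀ x : Fin (n + 1), (x : ℕ) + m = 2 * N ↔ x = a := fun x => by
      rw [Fin.ext_iff]; omega
    simp [gather, hiff]
  · push Not at h
    simp [gather, h]

/-- The transfer operator forgets the entries of odd frequency `N + m` and preserves the total
energy of the others. -/
theorem sum_energy_transfer (n : ℕ) (Φ : Fin (n + 1) → Fin (n + 1) → ℂ) :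
    ∑ N, energy n (transfer n Φ N)
      = ∑ N' : Fin (n + 1), ∑ m : Fin (n + 1),
        if Even ((N' : ℕ) + m) then ‖Φ N' m‖ ^ 2 / (n.choose m : ℝ) else 0 := by
  simp only [transfer_apply, energy_krawMatrix_mulVec]
  simp only [energy, norm_gather_sq, Finset.sum_div]
  refine Finset.sum_comm.trans (Eq.trans ?_ Finset.sum_comm)
  refine Finset.sum_congr rfl fun m _ => ?_
  rw [Finset.sum_comm]
  refine Finset.sum_congr rfl fun N' _ => ?_
  by_cases h : Even ((N' : ℕ) + m)
  · obtain ⟨r, hr⟩ := h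
    have hr' : r < n + 1 := by have := N'.2; have := m.2; omega
    rw [if_pos ⟨r, hr⟩, Finset.sum_eq_single ⟨r, hr'⟩]
    · rw [if_pos (by simp only; omega)]
    · intro x _ hx
      rw [if_neg fun h => hx (Fin.ext (by simp only; omega)), zero_div]
    · simp
  · have : ∀ x : Fin (n + 1), (N' : ℕ) + m ≠ 2 * x := fun x hx =>
      h ⟨x, by omega⟩
    simp [h, this]

/-- The dehomogenization of the binary form with coefficients `c`. -/
noncomputable def formPoly (n : ℕ) (c : Fin (n + 1) → ℂ) : ℂ[X] :=
  ∑ m : Fin (n + 1), C (c m) * X ^ (m : ℕ)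

theorem coeff_formPoly (n : ℕ) (c : Fin (n + 1) → ℂ) (m : Fin (n + 1)) :
    (formPoly n c).coeff m = c m := by
  simp [formPoly, finsetSum_coeff, coeff_X_pow, ← Fin.ext_iff]

theorem natDegree_formPoly_le (n : ℕ) (c : Fin (n + 1) → ℂ) : (formPoly n c).natDegree ≤ n :=
  natDegree_sum_le_of_forall_le _ _ fun m _ =>
    (natDegree_C_mul_X_pow_le _ _).trans (Nat.le_of_lt_succ m.2)

theorem formPoly_ne_zero {n : ℕ} {c : Fin (n + 1) → ℂ} (hc : c ≠ 0) : formPoly n c ≠ 0 := by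
  intro h
  apply hc
  funext m
  rw [← coeff_formPoly n c m, h]; simp

theorem formPoly_krawMatrix (n : ℕ) (c : Fin (n + 1) → ℂ) :
    formPoly n ((krawMatrix n).mulVec c)
      = ∑ m : Fin (n + 1), C (((Real.sqrt 2 : ℂ) ^ n)⁻¹ * c m) * kraw n m := by
  ext i
  by_cases hi : i < n + 1
  · have := coeff_formPoly n ((krawMatrix n).mulVec c) ⟨i, hi⟩
    simp only at this
    rw [this]
    simp only [Matrix.mulVec, dotProduct, krawMatrix, Matrix.of_apply, finsetSum_coeff,
      coeff_C_mul]
    exact Finset.sum_congr rfl fun m _ => by ring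
  · rw [coeff_eq_zero_of_natDegree_lt ((natDegree_formPoly_le _ _).trans_lt (by omega)),
      finsetSum_coeff]
    refine (Finset.sum_eq_zero fun m _ => ?_).symm
    rw [coeff_C_mul, coeff_eq_zero_of_natDegree_lt
      ((natDegree_kraw_le (Nat.le_of_lt_succ m.2)).trans_lt (by omega)), mul_zero]

theorem formPoly_comp_neg {n N : ℕ} {c : Fin (n + 1) → ℂ}
    (hc : ∀ m : Fin (n + 1), ¬ Even (N + m) → c m = 0) :
    (formPoly n c).comp (-X) = C ((-1) ^ N) * formPoly n c := by
  simp only [formPoly, Polynomial.sum_comp, Finset.mul_sum]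
  refine Finset.sum_congr rfl fun m _ => ?_
  by_cases h : Even (N + m)
  · have : ((-1 : ℂ[X]) ^ (m : ℕ)) = (-1) ^ N := by
      rcases Nat.even_or_odd N with h1 | h1
      · have h2 : Even (m : ℕ) := by rw [Nat.even_add] at h; tauto
        rw [h1.neg_one_pow, h2.neg_one_pow]
      · have h2 : Odd (m : ℕ) := by
          rw [Nat.even_add] at h
          rw [← Nat.not_even_iff_odd] at h1 ⊢; tauto
        rw [h1.neg_one_pow, h2.neg_one_pow]
    simp only [mul_comp, C_comp, X_pow_comp, neg_pow (X : ℂ[X]), this, map_pow, map_neg, map_one]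
    ring
  · simp [hc m h]

theorem isCoprime_one_add_X_one_sub_X : IsCoprime (1 + X : ℂ[X]) (1 - X) := by
  refine ⟨C (1 / 2), C (1 / 2), ?_⟩
  rw [← mul_add, show (1 + X + (1 - X) : ℂ[X]) = C 2 by rw [map_ofNat]; ring, ← C_mul]
  norm_num

/-- An even or odd polynomial divisible by `(1 - X) ^ r` or `(1 + X) ^ r` is divisible by both. -/
theorem two_mul_le_of_one_sub_X_pow_dvd {n N r : ℕ} {c : Fin (n + 1) → ℂ} (hc0 : c ≠ 0)
    (hc : ∀ m : Fin (n + 1), ¬ Even (N + m) → c m = 0)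
    (h : (1 - X : ℂ[X]) ^ r ∣ formPoly n c ∨ (1 + X : ℂ[X]) ^ r ∣ formPoly n c) : 2 * r ≤ n := by
  have hunit : IsUnit (C ((-1) ^ N) : ℂ[X]) := by
    rw [isUnit_C]; exact (IsUnit.neg isUnit_one).pow N
  have flip : ∀ q : ℂ[X], q ∣ formPoly n c → q.comp (-X) ∣ formPoly n c := by
    rintro q ⟨s, hs⟩
    rw [← hunit.dvd_mul_left, ← formPoly_comp_neg hc, hs, mul_comp]
    exact dvd_mul_right _ _
  have h2 : (1 - X : ℂ[X]) ^ r ∣ formPoly n c ∧ (1 + X : ℂ[X]) ^ r ∣ formPoly n c := by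
    rcases h with h | h
    · exact ⟨h, by simpa using flip _ h⟩
    · exact ⟨by simpa [← sub_eq_add_neg] using flip _ h, h⟩
  have h3 : (1 + X : ℂ[X]) ^ r * (1 - X) ^ r ∣ formPoly n c :=
    isCoprime_one_add_X_one_sub_X.pow.mul_dvd h2.2 h2.1
  have h4 := natDegree_le_of_dvd h3 (formPoly_ne_zero hc0)
  have e1 : (1 + X : ℂ[X]).natDegree = 1 := by compute_degree!
  have e2 : (1 - X : ℂ[X]).natDegree = 1 := by compute_degree!
  have n1 : (1 + X : ℂ[X]) ≠ 0 := fun h => by simp [h] at e1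
  have n2 : (1 - X : ℂ[X]) ≠ 0 := fun h => by simp [h] at e2
  rw [natDegree_mul (pow_ne_zero _ n1) (pow_ne_zero _ n2), natDegree_pow, natDegree_pow, e1,
    e2] at h4
  have := natDegree_formPoly_le n c
  omega

/-- Every eigenvalue of the transfer operator in positive degree has modulus less than `1`. -/
theorem norm_lt_one_of_transfer_eq_smul {n : ℕ} (hn : 1 ≤ n)
    {Φ : Fin (n + 1) → Fin (n + 1) → ℂ} (hΦ : Φ ≠ 0) {l : ℂ} (h : transfer n Φ = l • Φ) :
    ‖l‖ < 1 := by
  by_contra! hl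
  have hl0 : l ≠ 0 := fun h0 => by simp [h0] at hl; linarith
  -- Comparing energies, `Φ` is supported on the entries with `N + m` even.
  have hodd : ∀ N m : Fin (n + 1), ¬ Even ((N : ℕ) + m) → Φ N m = 0 := by
    have h1 := sum_energy_transfer n Φ
    have h2 : ∑ N, energy n (transfer n Φ N)
        = ‖l‖ ^ 2 * ∑ N : Fin (n + 1), ∑ m : Fin (n + 1), ‖Φ N m‖ ^ 2 / (n.choose m : ℝ) := by
      rw [h, Finset.mul_sum]
      refine Finset.sum_congr rfl fun N _ => ?_
      rw [energy, Finset.mul_sum]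
      refine Finset.sum_congr rfl fun m _ => ?_
      simp only [Pi.smul_apply, smul_eq_mul, norm_mul, mul_pow]
      ring
    have h3 : ∑ N : Fin (n + 1), ∑ m : Fin (n + 1), ‖Φ N m‖ ^ 2 / (n.choose m : ℝ)
        ≤ ‖l‖ ^ 2 * ∑ N : Fin (n + 1), ∑ m : Fin (n + 1), ‖Φ N m‖ ^ 2 / (n.choose m : ℝ) := by
      refine le_mul_of_one_le_left ?_ (one_le_pow₀ hl)
      exact Finset.sum_nonneg fun _ _ => Finset.sum_nonneg fun _ _ => by positivity
    rw [← h2, h1] at h3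
    have h4 : ∑ N : Fin (n + 1), ∑ m : Fin (n + 1),
        (if Even ((N : ℕ) + m) then 0 else ‖Φ N m‖ ^ 2 / (n.choose m : ℝ)) ≤ 0 := by
      have : ∑ N : Fin (n + 1), ∑ m : Fin (n + 1), ‖Φ N m‖ ^ 2 / (n.choose m : ℝ)
          = ∑ N : Fin (n + 1), ∑ m : Fin (n + 1),
              (if Even ((N : ℕ) + m) then 0 else ‖Φ N m‖ ^ 2 / (n.choose m : ℝ))
            + ∑ N : Fin (n + 1), ∑ m : Fin (n + 1),
              (if Even ((N : ℕ) + m) then ‖Φ N m‖ ^ 2 / (n.choose m : ℝ) else 0) := by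
        simp only [← Finset.sum_add_distrib]
        exact Finset.sum_congr rfl fun _ _ => Finset.sum_congr rfl fun _ _ => by
          split_ifs <;> simp
      linarith
    have nn : ∀ N m : Fin (n + 1),
        0 ≤ (if Even ((N : ℕ) + m) then 0 else ‖Φ N m‖ ^ 2 / (n.choose m : ℝ)) :=
      fun N m => by split_ifs <;> positivity
    have h5 := le_antisymm h4 (Finset.sum_nonneg fun _ _ => Finset.sum_nonneg fun _ _ => nn _ _)
    intro N m hNm
    rw [Finset.sum_eq_zero_iff_of_nonneg fun _ _ => Finset.sum_nonneg fun _ _ => nn _ _] at h5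
    have h6 := h5 N (Finset.mem_univ _)
    rw [Finset.sum_eq_zero_iff_of_nonneg fun _ _ => nn _ _] at h6
    have h7 := h6 m (Finset.mem_univ _)
    have hch : (n.choose m : ℝ) ≠ 0 := by
      exact_mod_cast (Nat.choose_pos (Nat.le_of_lt_succ m.2)).ne'
    simpa [hNm, hch] using h7
  have hrow : ∀ N, Φ N = (krawMatrix n).mulVec (l⁻¹ • gather n Φ N) := fun N => by
    have := congrFun h N
    rw [transfer_apply, Pi.smul_apply] at this
    rw [Matrix.mulVec_smul, this, smul_smul, inv_mul_cancel₀ hl0, one_smul]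
  have hpoly : ∀ N, formPoly n (Φ N) = ∑ m : Fin (n + 1),
      C (((Real.sqrt 2 : ℂ) ^ n)⁻¹ * (l⁻¹ * gather n Φ N m)) * kraw n m := fun N => by
    conv_lhs => rw [hrow N, formPoly_krawMatrix]
    rfl
  let S : Finset (Fin (n + 1)) := Finset.univ.filter fun N => Φ N ≠ 0
  have hS : S.Nonempty := by
    obtain ⟨N, hN⟩ := Function.ne_iff.mp hΦ
    exact ⟨N, by simpa [S] using hN⟩
  have hSmem : ∀ N, N ∈ S ↔ Φ N ≠ 0 := fun N => by simp [S]
  -- The top row is divisible by a high power of `1 - X`.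
  obtain ⟨p, hpS, hpmax⟩ := S.exists_max_image id hS
  have hgp : ∀ m : Fin (n + 1), (m : ℕ) < p → gather n Φ p m = 0 := fun m hm => by
    refine Finset.sum_eq_zero fun N' _ => ?_
    split_ifs with hN'
    · have : N' ∉ S := fun hmem => by
        have : (N' : ℕ) ≤ p := hpmax N' hmem
        omega
      rw [hSmem, not_not] at this
      rw [this]; rfl
    · rfl
  have hdp : (1 - X : ℂ[X]) ^ (p : ℕ) ∣ formPoly n (Φ p) := by
    rw [hpoly p]
    refine Finset.dvd_sum fun m _ => ?_
    by_cases hm : (m : ℕ) < p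
    · simp [hgp m hm]
    · exact ((pow_dvd_pow _ (not_lt.mp hm)).mul_left _).mul_left _
  have hp2 : 2 * (p : ℕ) ≤ n :=
    two_mul_le_of_one_sub_X_pow_dvd ((hSmem p).1 hpS) (hodd p) (Or.inl hdp)
  -- The bottom row is divisible by a high power of `1 + X`.
  obtain ⟨q, hqS, hqmin⟩ := S.exists_min_image id hS
  have hgq : ∀ m : Fin (n + 1), (q : ℕ) < m → gather n Φ q m = 0 := fun m hm => by
    refine Finset.sum_eq_zero fun N' _ => ?_
    split_ifs with hN'
    · have : N' ∉ S := fun hmem => by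
        have : (q : ℕ) ≤ N' := hqmin N' hmem
        omega
      rw [hSmem, not_not] at this
      rw [this]; rfl
    · rfl
  have hdq : (1 + X : ℂ[X]) ^ (n - (q : ℕ)) ∣ formPoly n (Φ q) := by
    rw [hpoly q]
    refine Finset.dvd_sum fun m _ => ?_
    by_cases hm : (q : ℕ) < m
    · simp [hgq m hm]
    · exact ((pow_dvd_pow _ (by omega)).mul_right _).mul_left _
  have hq2 : 2 * (n - (q : ℕ)) ≤ n :=
    two_mul_le_of_one_sub_X_pow_dvd ((hSmem q).1 hqS) (hodd q) (Or.inr hdq)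
  have hqp : (q : ℕ) ≤ p := hqmin p hpS
  have hqn := q.2
  -- Hence `Φ` has a single nonzero row `p = n / 2`.
  have hzero : ∀ N, N ≠ p → Φ N = 0 := fun N hN => by
    by_contra hne
    have h1 : (N : ℕ) ≤ p := hpmax N ((hSmem N).2 hne)
    have h2 : (q : ℕ) ≤ N := hqmin N ((hSmem N).2 hne)
    exact hN (Fin.ext (by omega))
  have hentry : ∀ m, m ≠ p → Φ p m = 0 := fun m hm => by
    by_cases hev : Even ((p : ℕ) + m)
    · obtain ⟨r, hr⟩ := hev
      have hrn : r < n + 1 := by omega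
      have hrp : (⟨r, hrn⟩ : Fin (n + 1)) ≠ p := fun h => by
        apply hm
        rw [Fin.ext_iff] at h ⊢
        simp only at h
        omega
      have h1 : transfer n Φ ⟨r, hrn⟩ = 0 := by
        rw [h, Pi.smul_apply, hzero _ hrp, smul_zero]
      have h2 : gather n Φ ⟨r, hrn⟩ = 0 := by
        have := congrArg (krawMatrix n).mulVec h1
        rwa [transfer_apply, Matrix.mulVec_mulVec, krawMatrix_mul_self, Matrix.one_mulVec,
          Matrix.mulVec_zero] at this
      have h3 := congrFun h2 m
      rw [gather, Finset.sum_eq_single p] at h3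
      · rw [if_pos (by simp only; omega)] at h3
        exact h3
      · intro b _ hb
        rw [hzero b hb]; simp
      · simp
    · exact hodd p m hev
  -- So the row is a monomial, but it vanishes at `1`.
  have hmono : formPoly n (Φ p) = C (Φ p p) * X ^ (p : ℕ) := by
    rw [formPoly, Finset.sum_eq_single p]
    · intro b _ hb
      simp [hentry b hb]
    · simp
  have hpp : Φ p p = 0 := by
    have h1 : (1 - X : ℂ[X]) ∣ formPoly n (Φ p) :=
      (dvd_pow_self _ (by omega)).trans hdp
    obtain ⟨s, hs⟩ := h1
    have h2 := congrArg (eval 1) hs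
    rw [hmono] at h2
    simpa using h2
  refine (hSmem p).1 hpS (funext fun m => ?_)
  by_cases hm : m = p
  · rw [hm, hpp]; rfl
  · exact hentry m hm

/-- Gelfand's formula, applied in finite dimension, where the spectrum consists of eigenvalues. -/
theorem tendsto_pow_apply_of_eigenvalues_norm_lt_one {E : Type*} [NormedAddCommGroup E]
    [NormedSpace ℂ E] [FiniteDimensional ℂ E] (T : E →ₗ[ℂ] E)
    (hT : ∀ (x : E) (l : ℂ), x ≠ 0 → T x = l • x → ‖l‖ < 1) (x : E) :
    Tendsto (fun k : ℕ => (T ^ k) x) atTop (𝓝 0) := by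
  have : CompleteSpace E := FiniteDimensional.complete ℂ E
  rcases subsingleton_or_nontrivial E with hE | hE
  · simp [Subsingleton.elim _ (0 : E)]
  let L : E →L[ℂ] E := LinearMap.toContinuousLinearMap T
  have hspec : ∀ l ∈ spectrum ℂ L, ‖l‖₊ < (1 : NNReal) := by
    intro l hl
    have h1 : l ∈ spectrum ℂ T := by
      rw [spectrum.mem_iff] at hl ⊢
      contrapose! hl
      obtain ⟨u, hu⟩ := hl
      rw [isUnit_iff_exists]
      refine ⟨LinearMap.toContinuousLinearMap (u⁻¹ : (E →ₗ[ℂ] E)ˣ).val, ?_, ?_⟩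
      · ext y
        have := LinearMap.congr_fun (u.mul_inv) y
        rw [hu] at this
        exact this
      · ext y
        have := LinearMap.congr_fun (u.inv_mul) y
        rw [hu] at this
        exact this
    rw [← Module.End.hasEigenvalue_iff_mem_spectrum] at h1
    obtain ⟨v, hv⟩ := h1.exists_hasEigenvector
    exact hT v l hv.2 hv.apply_eq_smul
  have hr : spectralRadius ℂ L < 1 := by
    exact_mod_cast spectrum.spectralRadius_lt_of_forall_lt L hspec
  have hg := spectrum.pow_nnnorm_pow_one_div_tendsto_nhds_spectralRadius L
  obtain ⟨r, hr1, hr2⟩ := exists_between hr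
  lift r to NNReal using (hr2.trans ENNReal.one_lt_top).ne
  have hev : ∀ᶠ k : ℕ in atTop, ‖L ^ k‖₊ ≤ r ^ k := by
    filter_upwards [hg.eventually_lt_const hr1, eventually_gt_atTop 0] with k hk hk0
    have h2 : ((‖L ^ k‖₊ : ENNReal) ^ (1 / k : ℝ)) ^ (k : ℝ) ≤ (r : ENNReal) ^ (k : ℝ) :=
      ENNReal.rpow_le_rpow hk.le (by positivity)
    rw [← ENNReal.rpow_mul, one_div_mul_cancel (by positivity), ENNReal.rpow_one,
      ENNReal.rpow_natCast] at h2
    exact_mod_cast h2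
  have hL : Tendsto (fun k : ℕ => L ^ k) atTop (𝓝 0) := by
    rw [tendsto_zero_iff_norm_tendsto_zero]
    refine squeeze_zero' (Eventually.of_forall fun _ => norm_nonneg _)
      (hev.mono fun k hk => ?_)
      (tendsto_pow_atTop_nhds_zero_of_lt_one r.2 (by exact_mod_cast hr2 : (r : ℝ) < 1))
    exact_mod_cast hk
  have h3 := ((ContinuousLinearMap.apply ℂ E x).continuous.tendsto 0).comp hL
  simp only [map_zero] at h3
  refine h3.congr fun k => ?_
  simp only [Function.comp, ContinuousLinearMap.apply_apply]
  induction k with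
  | zero => rfl
  | succ k ih => rw [pow_succ', pow_succ', Module.End.mul_apply, ← ih]; rfl

theorem tendsto_transfer_pow {n : ℕ} (hn : 1 ≤ n) (Φ : Fin (n + 1) → Fin (n + 1) → ℂ) :
    Tendsto (fun k : ℕ => (transfer n ^ k) Φ) atTop (𝓝 0) :=
  tendsto_pow_apply_of_eigenvalues_norm_lt_one _
    (fun _ _ h0 h => norm_lt_one_of_transfer_eq_smul hn h0 h) Φ

/-! ### Means over the circle and the cocycle -/

theorem integral_circleUniform {f : ℂ → ℂ} (hf : Continuous f) :
    ∫ z, f z ∂circleUniform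
      = (2 * Real.pi)⁻¹ • ∫ θ in (0 : ℝ)..2 * Real.pi, f (Complex.exp (θ * Complex.I)) := by
  rw [circleUniform, integral_map (by fun_prop) hf.aestronglyMeasurable,
    intervalIntegral.integral_of_le (by positivity), ProbabilityTheory.cond, integral_smul_measure]
  simp [Real.volume_Ioc, Real.pi_pos.le]

instance isProbabilityMeasure_circleUniform : IsProbabilityMeasure circleUniform := by
  have : IsProbabilityMeasure (volume[|Set.Ioc (0 : ℝ) (2 * Real.pi)]) :=
    cond_isProbabilityMeasure_of_finite (by simp [Real.pi_pos]) (by simp [ENNReal.mul_eq_top])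
  exact Measure.isProbabilityMeasure_map (by fun_prop)

theorem ae_norm_eq_one_circleUniform : ∀ᵐ z ∂circleUniform, ‖z‖ = 1 := by
  rw [circleUniform, ae_map_iff (by fun_prop) (measurableSet_eq_fun (by fun_prop) (by fun_prop))]
  exact Eventually.of_forall fun θ => Complex.norm_exp_ofReal_mul_I θ

theorem integrable_circleUniform {f : ℂ → ℂ} (hf : Continuous f) :
    Integrable f circleUniform := by
  obtain ⟨B, hB⟩ := (isCompact_sphere (0 : ℂ) 1).exists_bound_of_continuousOn hf.continuousOn
  refine Integrable.of_bound hf.aestronglyMeasurable B ?_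
  filter_upwards [ae_norm_eq_one_circleUniform] with z hz
  exact hB z (by simpa using hz)

theorem integral_circleUniform_rotate {f : ℂ → ℂ} (hf : Continuous f) (α : ℝ) :
    ∫ z, f (Complex.exp (α * Complex.I) * z) ∂circleUniform = ∫ z, f z ∂circleUniform := by
  rw [integral_circleUniform hf, integral_circleUniform (by fun_prop)]
  congr 1
  have hper : Function.Periodic (fun θ : ℝ => f (Complex.exp (θ * Complex.I))) (2 * Real.pi) :=
    fun θ => by
      simp only
      push_cast
      rw [add_mul, Complex.exp_periodic]
  have h1 := intervalIntegral.integral_comp_add_right (a := 0) (b := 2 * Real.pi)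
    (fun θ : ℝ => f (Complex.exp (θ * Complex.I))) α
  have h2 := hper.intervalIntegral_add_eq α 0
  rw [zero_add] at h1 h2
  rw [add_comm (2 * Real.pi) α, h2] at h1
  rw [← h1]
  congr 1
  funext θ
  rw [← Complex.exp_add]
  congr 2
  push_cast
  ring

theorem integral_circleUniform_sq {f : ℂ → ℂ} (hf : Continuous f) :
    ∫ z, f (z ^ 2) ∂circleUniform = ∫ z, f z ∂circleUniform := by
  rw [integral_circleUniform hf, integral_circleUniform (by fun_prop)]
  congr 1
  have hper : Function.Periodic (fun θ : ℝ => f (Complex.exp (θ * Complex.I))) (2 * Real.pi) :=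
    fun θ => by
      simp only
      push_cast
      rw [add_mul, Complex.exp_periodic]
  have hcont : Continuous (fun θ : ℝ => f (Complex.exp (θ * Complex.I))) := by fun_prop
  have h1 := intervalIntegral.integral_comp_mul_left (a := 0) (b := 2 * Real.pi)
    (fun θ : ℝ => f (Complex.exp (θ * Complex.I))) (two_ne_zero)
  have h2 := hper.intervalIntegral_add_zsmul_eq 2 0
    (fun a b => hcont.intervalIntegrable a b)
  rw [zero_add, zero_add, zsmul_eq_mul] at h2
  have e1 : (fun θ : ℝ => f (Complex.exp (((2 * θ : ℝ) : ℂ) * Complex.I)))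
      = fun θ : ℝ => f (Complex.exp (θ * Complex.I) ^ 2) := by
    funext θ
    rw [← Complex.exp_nat_mul]
    congr 2
    push_cast
    ring
  rw [e1, mul_zero] at h1
  rw [h1]
  push_cast at h2
  rw [h2, zsmul_eq_mul, Complex.real_smul]
  push_cast
  ring

theorem integral_circleUniform_sq_mul_pow {f : ℂ → ℂ} (hf : Continuous f) (M : ℕ) :
    ∫ z, f (z ^ 2) * z ^ M ∂circleUniform
      = if Even M then ∫ z, f z * z ^ (M / 2) ∂circleUniform else 0 := by
  split_ifs with h
  · obtain ⟨r, rfl⟩ := h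
    rw [← integral_circleUniform_sq (f := fun z => f z * z ^ ((r + r) / 2)) (by fun_prop)]
    congr 1
    funext z
    rw [← pow_mul, show 2 * ((r + r) / 2) = r + r by omega]
  · have h1 := integral_circleUniform_rotate (f := fun z => f (z ^ 2) * z ^ M) (by fun_prop) Real.pi
    simp only [Complex.exp_pi_mul_I, neg_one_mul, neg_sq,
      (Nat.not_even_iff_odd.mp h).neg_pow, mul_neg] at h1
    rw [integral_neg] at h1
    linear_combination (-1 / 2 : ℂ) * h1

theorem integral_circleUniform_conj_pow_mul_pow (e N : ℕ) :
    ∫ z, (starRingEnd ℂ) z ^ e * z ^ N ∂circleUniform = if N = e then 1 else 0 := by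
  split_ifs with h
  · subst h
    have : ∀ᵐ z ∂circleUniform, (starRingEnd ℂ) z ^ N * z ^ N = 1 := by
      filter_upwards [ae_norm_eq_one_circleUniform] with z hz
      rw [← mul_pow, Complex.conj_mul', hz]; simp
    rw [integral_congr_ae this]; simp
  · have hne : ((N : ℂ) - e) ≠ 0 := sub_ne_zero.mpr (by exact_mod_cast h)
    set α : ℝ := Real.pi / ((N : ℝ) - e) with hα
    have h1 := integral_circleUniform_rotate
      (f := fun z => (starRingEnd ℂ) z ^ e * z ^ N) (by fun_prop) α
    -- Rotating by `α = π / (N - e)` changes the sign of the integrand.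
    have h2 : ∀ z : ℂ, (starRingEnd ℂ) (Complex.exp (α * Complex.I) * z) ^ e
        * (Complex.exp (α * Complex.I) * z) ^ N = -((starRingEnd ℂ) z ^ e * z ^ N) := fun z => by
      have h3 : (starRingEnd ℂ) (Complex.exp (α * Complex.I)) ^ e
          * Complex.exp (α * Complex.I) ^ N = -1 := by
        rw [← Complex.exp_conj, ← Complex.exp_nat_mul, ← Complex.exp_nat_mul, ← Complex.exp_add,
          ← Complex.exp_pi_mul_I]
        congr 1
        simp only [map_mul, Complex.conj_ofReal, Complex.conj_I, hα]
        push_cast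
        field_simp
        ring
      rw [map_mul, mul_pow, mul_pow]
      linear_combination ((starRingEnd ℂ) z ^ e * z ^ N) * h3
    simp only [h2] at h1
    rw [integral_neg] at h1
    linear_combination (-1 / 2 : ℂ) * h1

/-- The matrix of one step of the Rudin-Shapiro recursion on binary forms of degree `n`, up to the
scalar by which it differs from an element of `SU(2)`. -/
noncomputable def stepMatrix (n : ℕ) (w : ℂ) : Matrix (Fin (n + 1)) (Fin (n + 1)) ℂ :=
  krawMatrix n * Matrix.diagonal fun m : Fin (n + 1) => w ^ (m : ℕ)

/-- The cocycle `stepMatrix n (z ^ 2 ^ (k - 1)) * ⋯ * stepMatrix n (z ^ 2) * stepMatrix n z`. -/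
noncomputable def cocycle (n : ℕ) : ℕ → ℂ → Matrix (Fin (n + 1)) (Fin (n + 1)) ℂ
  | 0, _ => 1
  | k + 1, z => stepMatrix n (z ^ 2 ^ k) * cocycle n k z

theorem cocycle_succ' (n k : ℕ) (z : ℂ) :
    cocycle n (k + 1) z = cocycle n k (z ^ 2) * stepMatrix n z := by
  induction k with
  | zero => simp [cocycle]
  | succ k ih =>
    rw [cocycle, ih, cocycle, ← mul_assoc, ← pow_mul, ← pow_succ']

theorem continuous_cocycle (n k : ℕ) : Continuous (cocycle n k) := by
  induction k with
  | zero => exact continuous_const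
  | succ k ih =>
    have : Continuous fun z : ℂ => stepMatrix n (z ^ 2 ^ k) :=
      continuous_const.matrix_mul (Continuous.matrix_diagonal (by fun_prop))
    exact this.matrix_mul ih

/-- The Fourier coefficient of the cocycle which picks out the frequency `e * 2 ^ k - N`. -/
noncomputable def cocycleCoeff (n e k : ℕ) (i a : Fin (n + 1)) (N : ℕ) : ℂ :=
  ∫ z, (starRingEnd ℂ) z ^ (e * 2 ^ k) * cocycle n k z i a * z ^ N ∂circleUniform

/-- Splitting off the step at `z` leaves a function of `z ^ 2`, whose mean against `z ^ (N + m)`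
vanishes for `N + m` odd. -/
theorem cocycleCoeff_succ (n e k : ℕ) (i m N : Fin (n + 1)) :
    cocycleCoeff n e (k + 1) i m N = ∑ a, krawMatrix n a m *
      ∑ N' : Fin (n + 1), if (N : ℕ) + m = 2 * N' then cocycleCoeff n e k i a N' else 0 := by
  have hent : ∀ a, Continuous fun z => cocycle n k z i a := fun a =>
    (continuous_cocycle n k).matrix_elem i a
  have h1 : ∀ z, (starRingEnd ℂ) z ^ (e * 2 ^ (k + 1)) * cocycle n (k + 1) z i m * z ^ (N : ℕ)
      = ∑ a, krawMatrix n a m * (((starRingEnd ℂ) (z ^ 2) ^ (e * 2 ^ k) * cocycle n k (z ^ 2) i a)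
        * z ^ ((N : ℕ) + m)) := fun z => by
    rw [cocycle_succ', Matrix.mul_apply, Finset.mul_sum, Finset.sum_mul]
    refine Finset.sum_congr rfl fun a _ => ?_
    rw [stepMatrix, Matrix.mul_diagonal, map_pow, ← pow_mul]
    ring
  rw [cocycleCoeff]
  simp only [h1]
  rw [integral_finsetSum _ fun a _ => integrable_circleUniform (by
    have := hent a
    fun_prop)]
  refine Finset.sum_congr rfl fun a _ => ?_
  rw [integral_const_mul, integral_circleUniform_sq_mul_pow
    (f := fun z => (starRingEnd ℂ) z ^ (e * 2 ^ k) * cocycle n k z i a)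
    (by have := hent a; fun_prop)]
  congr 1
  split_ifs with h
  · obtain ⟨r, hr⟩ := h
    rw [Finset.sum_eq_single ⟨r, by omega⟩]
    · rw [if_pos (by simp only; omega), hr, show (r + r) / 2 = r by omega]; rfl
    · intro x _ hx
      rw [if_neg fun h => hx (Fin.ext (by simp only; omega))]
    · simp
  · symm
    apply Finset.sum_eq_zero
    intro x _
    exact if_neg fun hx => h ⟨x, by omega⟩

/-- The mean of `z̄ ^ (e * 2 ^ k) * cocycle n k z`, applied to the vector `∑ N, z ^ N • Ψ N`, is
row `e` of the `k`-th power of the transfer operator at `Ψ`. -/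
theorem sum_cocycleCoeff_mul (n k : ℕ) (e i : Fin (n + 1)) (Ψ : Fin (n + 1) → Fin (n + 1) → ℂ) :
    ∑ a : Fin (n + 1), ∑ N : Fin (n + 1), cocycleCoeff n e k i a N * Ψ N a
      = (transfer n ^ k) Ψ e i := by
  induction k generalizing Ψ with
  | zero =>
    have h0 : ∀ a N : Fin (n + 1), cocycleCoeff n e 0 i a N
        = if i = a then (if N = e then 1 else 0) else 0 := fun a N => by
      simp only [cocycleCoeff, cocycle, pow_zero, mul_one, Matrix.one_apply]
      split_ifs with h1 h2
      · simp only [mul_one, h2]; rw [integral_circleUniform_conj_pow_mul_pow, if_pos rfl]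
      · simp only [mul_one]
        rw [integral_circleUniform_conj_pow_mul_pow, if_neg fun h => h2 (Fin.ext h)]
      · simp
    simp [h0]
  | succ k ih =>
    rw [pow_succ, Module.End.mul_apply, ← ih]
    simp only [cocycleCoeff_succ, transfer_apply, Matrix.mulVec, dotProduct, gather,
      Finset.sum_mul, Finset.mul_sum]
    -- Both sides are sums over `(a, N, m, N')` of the same terms.
    calc ∑ m : Fin (n + 1), ∑ N : Fin (n + 1), ∑ a : Fin (n + 1), ∑ N' : Fin (n + 1),
          (krawMatrix n a m * if (N : ℕ) + m = 2 * N' then cocycleCoeff n e k i a N' else 0) * Ψ N m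
        = ∑ m : Fin (n + 1), ∑ a : Fin (n + 1), ∑ N' : Fin (n + 1), ∑ N : Fin (n + 1),
          (krawMatrix n a m * if (N : ℕ) + m = 2 * N' then cocycleCoeff n e k i a N' else 0)
            * Ψ N m := by
          refine Finset.sum_congr rfl fun m _ => ?_
          rw [Finset.sum_comm]
          exact Finset.sum_congr rfl fun a _ => Finset.sum_comm
      _ = ∑ a : Fin (n + 1), ∑ N' : Fin (n + 1), ∑ m : Fin (n + 1), ∑ N : Fin (n + 1),
          (krawMatrix n a m * if (N : ℕ) + m = 2 * N' then cocycleCoeff n e k i a N' else 0)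
            * Ψ N m := by
          rw [Finset.sum_comm]
          exact Finset.sum_congr rfl fun a _ => Finset.sum_comm
      _ = _ := by
          refine Finset.sum_congr rfl fun a _ => Finset.sum_congr rfl fun N' _ =>
            Finset.sum_congr rfl fun m _ => Finset.sum_congr rfl fun N _ => ?_
          split_ifs <;> ring

/-! ### Rudin-Shapiro pairs as a cocycle on binary forms -/

/-- The normalized value `P k (z) / √(2 ^ (k + 1))`. -/
noncomputable def normP (k : ℕ) (z : ℂ) : ℂ :=
  (P k).eval z / ((Real.sqrt (2 ^ (k + 1)) : ℝ) : ℂ)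

/-- The normalized value `Q k (z) / √(2 ^ (k + 1))`. -/
noncomputable def normQ (k : ℕ) (z : ℂ) : ℂ :=
  (Q k).eval z / ((Real.sqrt (2 ^ (k + 1)) : ℝ) : ℂ)

theorem sqrt_two_ne_zero : (Real.sqrt 2 : ℂ) ≠ 0 := by
  exact_mod_cast (Real.sqrt_pos.mpr (by norm_num : (0 : ℝ) < 2)).ne'

theorem ofReal_sqrt_two_pow_succ (k : ℕ) :
    ((Real.sqrt (2 ^ (k + 1)) : ℝ) : ℂ) = (Real.sqrt (2 ^ k) : ℝ) * (Real.sqrt 2 : ℝ) := by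
  rw [pow_succ, Real.sqrt_mul (by positivity), Complex.ofReal_mul]

theorem normP_succ (k : ℕ) (z : ℂ) :
    normP (k + 1) z = (Real.sqrt 2 : ℂ)⁻¹ * (normP k z + z ^ 2 ^ k * normQ k z) := by
  rw [normP, normP, normQ, ofReal_sqrt_two_pow_succ (k + 1)]
  simp only [P, Q, pair, eval_add, eval_mul, eval_pow, eval_X]
  field_simp [sqrt_two_ne_zero]

theorem normQ_succ (k : ℕ) (z : ℂ) :
    normQ (k + 1) z = (Real.sqrt 2 : ℂ)⁻¹ * (normP k z - z ^ 2 ^ k * normQ k z) := by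
  rw [normQ, normP, normQ, ofReal_sqrt_two_pow_succ (k + 1)]
  simp only [P, Q, pair, eval_sub, eval_mul, eval_pow, eval_X]
  field_simp [sqrt_two_ne_zero]

theorem normP_zero (z : ℂ) : normP 0 z = (Real.sqrt 2 : ℂ)⁻¹ := by
  simp [normP, P, pair]

theorem normQ_zero (z : ℂ) : normQ 0 z = (Real.sqrt 2 : ℂ)⁻¹ := by
  simp [normQ, Q, pair]

theorem continuous_normP (k : ℕ) : Continuous (normP k) := by
  unfold normP; fun_prop

theorem conj_mul_self_of_norm_eq_one {z : ℂ} (hz : ‖z‖ = 1) : (starRingEnd ℂ) z * z = 1 := by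
  rw [Complex.conj_mul', hz]; simp

theorem inv_sqrt_two_mul_self : (Real.sqrt 2 : ℂ)⁻¹ * (Real.sqrt 2 : ℂ)⁻¹ = 1 / 2 := by
  rw [← mul_inv, ← Complex.ofReal_mul, Real.mul_self_sqrt (by norm_num)]; norm_num

theorem conj_inv_sqrt_two : (starRingEnd ℂ) (Real.sqrt 2 : ℂ)⁻¹ = (Real.sqrt 2 : ℂ)⁻¹ := by
  rw [map_inv₀, Complex.conj_ofReal]

theorem normP_mul_conj_add_normQ_mul_conj (k : ℕ) {z : ℂ} (hz : ‖z‖ = 1) :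
    normP k z * (starRingEnd ℂ) (normP k z) + normQ k z * (starRingEnd ℂ) (normQ k z) = 1 := by
  induction k with
  | zero =>
    rw [normP_zero, normQ_zero, conj_inv_sqrt_two, inv_sqrt_two_mul_self]; norm_num
  | succ k ih =>
    rw [normP_succ, normQ_succ]
    have hw := conj_mul_self_of_norm_eq_one (z := z ^ 2 ^ k) (by simp [hz])
    simp only [map_mul, map_add, map_sub, conj_inv_sqrt_two]
    generalize z ^ 2 ^ k = w at *
    linear_combination (2 * (normP k z * (starRingEnd ℂ) (normP k z) +
      w * normQ k z * (starRingEnd ℂ) w * (starRingEnd ℂ) (normQ k z))) * inv_sqrt_two_mul_self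
      + ih + normQ k z * (starRingEnd ℂ) (normQ k z) * hw

theorem norm_normP_le_one (k : ℕ) {z : ℂ} (hz : ‖z‖ = 1) : ‖normP k z‖ ≤ 1 := by
  have h := normP_mul_conj_add_normQ_mul_conj k hz
  rw [Complex.mul_conj', Complex.mul_conj'] at h
  have h2 : ‖normP k z‖ ^ 2 + ‖normQ k z‖ ^ 2 = 1 := by exact_mod_cast h
  nlinarith [sq_nonneg ‖normQ k z‖, norm_nonneg (normP k z)]

/-- The binary form `(x s + y t) ^ j * (-ȳ s + x̄ t) ^ e`, dehomogenized at `s = 1`, where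
`(x, y)` is the normalized Rudin-Shapiro pair. Its coefficients are matrix coefficients of an
irreducible representation of `SU(2)`. -/
noncomputable def formRS (j e k : ℕ) (z : ℂ) : ℂ[X] :=
  (C (normP k z) + C (normQ k z) * X) ^ j
    * (C (-(starRingEnd ℂ) (normQ k z)) + C ((starRingEnd ℂ) (normP k z)) * X) ^ e

/-- The vector of coefficients of `formRS`. -/
noncomputable def vecRS (j e k : ℕ) (z : ℂ) (m : Fin (j + e + 1)) : ℂ := (formRS j e k z).coeff m

theorem formRS_succ (j e k : ℕ) {z : ℂ} (hz : ‖z‖ = 1) :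
    formRS j e (k + 1) z = ∑ m ∈ Finset.range (j + e + 1),
      C ((-(starRingEnd ℂ) z ^ 2 ^ k) ^ e * ((Real.sqrt 2 : ℂ) ^ (j + e))⁻¹ * (z ^ 2 ^ k) ^ m
        * (formRS j e k z).coeff m) * kraw (j + e) m := by
  have hw := conj_mul_self_of_norm_eq_one (z := z ^ 2 ^ k) (by simp [hz])
  rw [← map_pow]
  have h := sum_coeff_linear_mul_linear (normP k z) (normQ k z) (-(starRingEnd ℂ) (normQ k z))
    ((starRingEnd ℂ) (normP k z)) j e (1 + X) (C (z ^ 2 ^ k) * (1 - X))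
  have h2 : ∀ m ∈ Finset.range (j + e + 1),
      C ((-(starRingEnd ℂ) (z ^ 2 ^ k)) ^ e * ((Real.sqrt 2 : ℂ) ^ (j + e))⁻¹ * (z ^ 2 ^ k) ^ m
        * (formRS j e k z).coeff m) * kraw (j + e) m
      = C ((-(starRingEnd ℂ) (z ^ 2 ^ k)) ^ e * ((Real.sqrt 2 : ℂ) ^ (j + e))⁻¹) *
        (C ((formRS j e k z).coeff m) * ((1 + X) ^ (j + e - m)
          * (C (z ^ 2 ^ k) * (1 - X)) ^ m)) := fun m _ => by
    simp only [kraw, mul_pow, C_mul, C_pow]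
    ring
  rw [Finset.sum_congr rfl h2, ← Finset.mul_sum]
  unfold formRS at h ⊢
  rw [h, normP_succ, normQ_succ]
  simp only [map_mul, map_add, map_sub, conj_inv_sqrt_two]
  generalize z ^ 2 ^ k = w at *
  have e1 : (C (Real.sqrt 2 : ℂ)⁻¹ * (C (normP k z) + C w * C (normQ k z)) +
      C (Real.sqrt 2 : ℂ)⁻¹ * (C (normP k z) - C w * C (normQ k z)) * X : ℂ[X])
      = C (Real.sqrt 2 : ℂ)⁻¹ * (C (normP k z) * (1 + X) + C (normQ k z) * (C w * (1 - X))) := by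
    ring
  have hwC : (C ((starRingEnd ℂ) w) * C w : ℂ[X]) = 1 := by rw [← C_mul, hw, C_1]
  have e2 : (C (-((Real.sqrt 2 : ℂ)⁻¹ * ((starRingEnd ℂ) (normP k z)
        - (starRingEnd ℂ) w * (starRingEnd ℂ) (normQ k z)))) +
      C (Real.sqrt 2 : ℂ)⁻¹ * (C ((starRingEnd ℂ) (normP k z))
        + C ((starRingEnd ℂ) w) * C ((starRingEnd ℂ) (normQ k z))) * X : ℂ[X])
      = C (-(starRingEnd ℂ) w) * C (Real.sqrt 2 : ℂ)⁻¹ *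
        (C (-(starRingEnd ℂ) (normQ k z)) * (1 + X)
          + C ((starRingEnd ℂ) (normP k z)) * (C w * (1 - X))) := by
    simp only [map_neg, map_mul, map_sub]
    linear_combination (C (Real.sqrt 2 : ℂ)⁻¹ * C ((starRingEnd ℂ) (normP k z)) * (1 - X)) * hwC
  rw [e1, e2, ← inv_pow, pow_add]
  simp only [mul_pow, C_pow, C_mul]
  ring

theorem vecRS_succ (j e k : ℕ) {z : ℂ} (hz : ‖z‖ = 1) :
    vecRS j e (k + 1) z = (-(starRingEnd ℂ) z ^ 2 ^ k) ^ e •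
      (stepMatrix (j + e) (z ^ 2 ^ k)).mulVec (vecRS j e k z) := by
  funext i
  simp only [vecRS]
  rw [formRS_succ j e k hz, finsetSum_coeff, Finset.sum_range]
  simp only [Pi.smul_apply, smul_eq_mul, Matrix.mulVec, dotProduct, Finset.mul_sum]
  refine Finset.sum_congr rfl fun m _ => ?_
  rw [coeff_C_mul, stepMatrix, Matrix.mul_diagonal, krawMatrix, Matrix.of_apply]
  simp only [vecRS]
  ring

/-- The second column of the `SU(2)` matrix picks up the scalar `-conj (z ^ 2 ^ r)` at step `r`; the
product of the powers `conj z ^ (e * 2 ^ r)`, `r < k`, is written as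
`conj z ^ (e * 2 ^ k) * z ^ e`. -/
theorem vecRS_eq_cocycle (j e k : ℕ) {z : ℂ} (hz : ‖z‖ = 1) :
    vecRS j e k z = ((-1) ^ (e * k) * (starRingEnd ℂ) z ^ (e * 2 ^ k) * z ^ e) •
      (cocycle (j + e) k z).mulVec (vecRS j e 0 1) := by
  induction k with
  | zero =>
    have h1 : (starRingEnd ℂ) z ^ e * z ^ e = 1 := by
      rw [← mul_pow, conj_mul_self_of_norm_eq_one hz, one_pow]
    have h2 : vecRS j e 0 z = vecRS j e 0 1 := by
      funext m
      simp only [vecRS, formRS, normP_zero, normQ_zero]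
    simp [cocycle, h1, h2]
  | succ k ih =>
    rw [vecRS_succ j e k hz, ih, Matrix.mulVec_smul, smul_smul, Matrix.mulVec_mulVec, cocycle]
    congr 1
    rw [neg_pow, ← pow_mul, pow_succ 2 k]
    ring

theorem integral_vecRS (j e k : ℕ) (i : Fin (j + e + 1)) :
    ∫ z, vecRS j e k z i ∂circleUniform = (-1) ^ (e * k) *
      (transfer (j + e) ^ k) (fun N a => if (N : ℕ) = e then vecRS j e 0 1 a else 0)
        ⟨e, by omega⟩ i := by
  have h1 : (fun z => vecRS j e k z i) =ᵐ[circleUniform] fun z => ∑ a,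
      ((-1) ^ (e * k) * vecRS j e 0 1 a) *
        ((starRingEnd ℂ) z ^ (e * 2 ^ k) * cocycle (j + e) k z i a * z ^ e) := by
    filter_upwards [ae_norm_eq_one_circleUniform] with z hz
    rw [vecRS_eq_cocycle j e k hz]
    simp only [Pi.smul_apply, smul_eq_mul, Matrix.mulVec, dotProduct, Finset.mul_sum]
    exact Finset.sum_congr rfl fun a _ => by ring
  rw [integral_congr_ae h1, integral_finsetSum _ fun a _ => integrable_circleUniform (by
    have := (continuous_cocycle (j + e) k).matrix_elem i a
    fun_prop), ← sum_cocycleCoeff_mul, Finset.mul_sum]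
  refine Finset.sum_congr rfl fun a _ => ?_
  rw [Finset.sum_eq_single ⟨e, by omega⟩, integral_const_mul, cocycleCoeff]
  · rw [if_pos rfl]; ring
  · intro N _ hN
    rw [if_neg fun h => hN (Fin.ext h), mul_zero]
  · simp

theorem tendsto_integral_coeff_formRS {j e : ℕ} (h : 1 ≤ j + e) :
    Tendsto (fun k => ∫ z, (formRS j e k z).coeff e ∂circleUniform) atTop (𝓝 0) := by
  have h1 := tendsto_transfer_pow h
    (fun N a => if (N : ℕ) = e then vecRS j e 0 1 a else 0)
  have h2 := (tendsto_pi_nhds.mp (tendsto_pi_nhds.mp h1 ⟨e, by omega⟩)) ⟨e, by omega⟩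
  simp only [Pi.zero_apply] at h2
  rw [tendsto_zero_iff_norm_tendsto_zero] at h2 ⊢
  refine h2.congr fun k => ?_
  have h3 := integral_vecRS j e k ⟨e, by omega⟩
  simp only [vecRS] at h3 ⊢
  rw [h3, norm_mul, norm_pow, norm_neg, norm_one, one_pow, one_mul]

theorem coeff_linear_mul_linear (x y a b : ℂ) (j e : ℕ) :
    ((C x + C y * X) ^ j * (C a + C b * X) ^ e).coeff e
      = ∑ i ∈ Finset.range (e + 1), (j.choose i : ℂ) * e.choose i * x ^ (j - i) * b ^ (e - i)
        * (y * a) ^ i := by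
  have hc : ∀ (x y : ℂ) (j i : ℕ),
      ((C x + C y * X) ^ j).coeff i = x ^ (j - i) * y ^ i * j.choose i := fun x y j i => by
    rw [add_comm, add_pow, finsetSum_coeff]
    have : ∀ r, ((C y * X) ^ r * C x ^ (j - r) * (j.choose r : ℂ[X]))
        = C (x ^ (j - r) * y ^ r * j.choose r) * X ^ r := fun r => by
      simp only [mul_pow, C_mul, C_pow, map_natCast]; ring
    simp only [this, coeff_C_mul, coeff_X_pow, mul_ite, mul_one, mul_zero]
    rw [Finset.sum_ite_eq]
    split_ifs with h
    · rfl
    · rw [Nat.choose_eq_zero_of_lt (by simpa using h)]; simp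
  rw [coeff_mul, Finset.Nat.sum_antidiagonal_eq_sum_range_succ_mk]
  refine Finset.sum_congr rfl fun i hi => ?_
  have hi' : i ≤ e := Nat.le_of_lt_succ (Finset.mem_range.mp hi)
  rw [hc, hc, Nat.sub_sub_self hi', Nat.choose_symm hi']
  ring

/-- The disc polynomial of bidegree `(j, e)`: a matrix coefficient of an irreducible
representation of `SU(2)`, expressed through the first entry `x` of the matrix. Where `j - i` is
truncated, the binomial coefficient vanishes. -/
noncomputable def discPoly (j e : ℕ) (x : ℂ) : ℂ :=
  ∑ i ∈ Finset.range (e + 1), (j.choose i : ℂ) * e.choose i *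
    (x ^ (j - i) * (starRingEnd ℂ) x ^ (e - i) * (x * (starRingEnd ℂ) x - 1) ^ i)

theorem tendsto_integral_discPoly {j e : ℕ} (h : 1 ≤ j + e) :
    Tendsto (fun k => ∫ z, discPoly j e (normP k z) ∂circleUniform) atTop (𝓝 0) := by
  refine (tendsto_integral_coeff_formRS h).congr fun k => integral_congr_ae ?_
  filter_upwards [ae_norm_eq_one_circleUniform] with z hz
  rw [formRS, coeff_linear_mul_linear, discPoly]
  refine Finset.sum_congr rfl fun i _ => ?_
  have : normQ k z * -(starRingEnd ℂ) (normQ k z)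
      = normP k z * (starRingEnd ℂ) (normP k z) - 1 := by
    linear_combination -(normP_mul_conj_add_normQ_mul_conj k hz)
  rw [this]
  ring

/-! ### Moments of the uniform distribution on the disc -/

/-- The uniform probability distribution on the closed unit disc. -/
noncomputable def discUniform : Measure ℂ := volume[|Metric.closedBall (0 : ℂ) 1]

theorem volume_unit_closedBall : volume (Metric.closedBall (0 : ℂ) 1) = ENNReal.ofReal Real.pi := by
  rw [Complex.volume_closedBall]
  simp [← NNReal.coe_real_pi, ENNReal.ofReal_coe_nnreal]

instance isProbabilityMeasure_discUniform : IsProbabilityMeasure discUniform :=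
  cond_isProbabilityMeasure_of_finite (by rw [volume_unit_closedBall]; simp [Real.pi_pos])
    (by rw [volume_unit_closedBall]; simp)

theorem ae_norm_le_one_discUniform : ∀ᵐ z ∂discUniform, ‖z‖ ≤ 1 := by
  filter_upwards [ae_cond_mem Metric.isClosed_closedBall.measurableSet] with z hz
  simpa using hz

theorem integral_discUniform (f : ℂ → ℂ) :
    ∫ z, f z ∂discUniform = Real.pi⁻¹ • ∫ z in Metric.closedBall (0 : ℂ) 1, f z := by
  rw [discUniform, ProbabilityTheory.cond, integral_smul_measure, volume_unit_closedBall]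
  simp [Real.pi_pos.le]

theorem integrable_discUniform {f : ℂ → ℂ} (hf : Continuous f) : Integrable f discUniform := by
  obtain ⟨B, hB⟩ := (isCompact_closedBall (0 : ℂ) 1).exists_bound_of_continuousOn hf.continuousOn
  refine Integrable.of_bound hf.aestronglyMeasurable B ?_
  filter_upwards [ae_norm_le_one_discUniform] with z hz
  exact hB z (by simpa using hz)

theorem integral_discUniform_rotate (f : ℂ → ℂ) (u : Circle) :
    ∫ z, f (u * z) ∂discUniform = ∫ z, f z ∂discUniform := by
  rw [integral_discUniform, integral_discUniform]
  congr 1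
  have h := (rotation u).measurePreserving.setIntegral_preimage_emb
    (rotation u).toHomeomorph.measurableEmbedding f (Metric.closedBall (0 : ℂ) 1)
  rw [← h]
  have : (rotation u) ⁻¹' Metric.closedBall (0 : ℂ) 1 = Metric.closedBall (0 : ℂ) 1 := by
    rw [LinearIsometryEquiv.preimage_closedBall, map_zero]
  rw [this]
  rfl

theorem integral_discUniform_mul_conj_pow (p : ℕ) :
    ∫ z, (z * (starRingEnd ℂ) z) ^ p ∂discUniform = 1 / (p + 1) := by
  rw [integral_discUniform, ← integral_indicator Metric.isClosed_closedBall.measurableSet]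
  have h1 : (Metric.closedBall (0 : ℂ) 1).indicator (fun z => (z * (starRingEnd ℂ) z) ^ p)
      = fun z => (fun r : ℝ => (Set.Iic (1 : ℝ)).indicator (fun r => ((r ^ (2 * p) : ℝ) : ℂ)) r)
        ‖z‖ := by
    funext z
    simp only [Set.indicator, Metric.mem_closedBall, dist_zero_right, Set.mem_Iic]
    rw [Complex.mul_conj', pow_mul]
    push_cast
    rfl
  rw [h1, integral_fun_norm_addHaar volume]
  have h2 : ∀ y : ℝ, y ^ (Module.finrank ℝ ℂ - 1) • (Set.Iic (1 : ℝ)).indicator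
      (fun r => ((r ^ (2 * p) : ℝ) : ℂ)) y
      = (Set.Iic (1 : ℝ)).indicator (fun r => ((r ^ (2 * p + 1) : ℝ) : ℂ)) y := fun y => by
    simp only [Set.indicator, Complex.finrank_real_complex]
    split_ifs
    · rw [Complex.real_smul, ← Complex.ofReal_mul]; congr 1; ring
    · simp
  simp only [h2]
  rw [integral_indicator measurableSet_Iic, Measure.restrict_restrict measurableSet_Iic,
    Set.Iic_inter_Ioi, integral_complex_ofReal, ← intervalIntegral.integral_of_le zero_le_one,
    integral_pow, Measure.real, Complex.volume_ball]
  simp only [Complex.finrank_real_complex]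
  have := Real.pi_ne_zero
  have hp : (p : ℂ) + 1 ≠ 0 := by exact_mod_cast p.succ_ne_zero
  simp only [ENNReal.ofReal_one, one_pow, one_mul, ENNReal.coe_toReal, NNReal.coe_real_pi,
    nsmul_eq_mul, Complex.real_smul]
  push_cast
  have hpi : (Real.pi : ℂ) ≠ 0 := by exact_mod_cast this
  have hp2 : (2 * (p : ℂ) + 1 + 1) ≠ 0 := by
    rw [show (2 * (p : ℂ) + 1 + 1) = 2 * (p + 1) by ring]
    exact mul_ne_zero two_ne_zero hp
  simp
  field_simp
  ring

/-- The Beta integral `∫ u ^ p * (u - 1) ^ q` over `[0, 1]`, as `u = |z| ^ 2` is uniform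
on `[0, 1]`. -/
theorem integral_discUniform_beta (p q : ℕ) :
    ∫ z, (z * (starRingEnd ℂ) z) ^ p * (z * (starRingEnd ℂ) z - 1) ^ q ∂discUniform
      = (-1) ^ q * (p.factorial * q.factorial) / (p + q + 1).factorial := by
  induction q generalizing p with
  | zero =>
    simp only [pow_zero, mul_one, integral_discUniform_mul_conj_pow, Nat.factorial_zero, add_zero,
      Nat.factorial_succ p]
    have h1 : (p.factorial : ℂ) ≠ 0 := by exact_mod_cast p.factorial_ne_zero
    have hp : (p : ℂ) + 1 ≠ 0 := by exact_mod_cast p.succ_ne_zero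
    push_cast
    field_simp
  | succ q ih =>
    have h : ∀ z : ℂ, (z * (starRingEnd ℂ) z) ^ p * (z * (starRingEnd ℂ) z - 1) ^ (q + 1)
        = (z * (starRingEnd ℂ) z) ^ (p + 1) * (z * (starRingEnd ℂ) z - 1) ^ q
          - (z * (starRingEnd ℂ) z) ^ p * (z * (starRingEnd ℂ) z - 1) ^ q := fun z => by ring
    simp only [h]
    rw [integral_sub (integrable_discUniform (by fun_prop)) (integrable_discUniform (by fun_prop)),
      ih, ih, show p + 1 + q + 1 = (p + q + 1) + 1 by ring,
      show p + (q + 1) + 1 = (p + q + 1) + 1 by ring, Nat.factorial_succ (p + q + 1),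
      Nat.factorial_succ p, Nat.factorial_succ q]
    have h1 : ((p + q + 1).factorial : ℂ) ≠ 0 := by exact_mod_cast (p + q + 1).factorial_ne_zero
    have h2 : (p : ℂ) + q + 1 + 1 ≠ 0 := by exact_mod_cast (p + q + 1).succ_ne_zero
    push_cast
    field_simp
    ring

theorem continuous_discPoly (j e : ℕ) : Continuous (discPoly j e) := by
  unfold discPoly; fun_prop

theorem integral_discPoly {j e : ℕ} (h : 1 ≤ j + e) : ∫ z, discPoly j e z ∂discUniform = 0 := by
  unfold discPoly
  rw [integral_finsetSum _ fun i _ => integrable_discUniform (by fun_prop)]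
  simp only [integral_const_mul]
  by_cases hje : j = e
  · subst hje
    have h1 : ∀ i ∈ Finset.range (j + 1), (j.choose i : ℂ) * j.choose i *
        ∫ z, z ^ (j - i) * (starRingEnd ℂ) z ^ (j - i) * (z * (starRingEnd ℂ) z - 1) ^ i
          ∂discUniform = ((j : ℂ) + 1)⁻¹ * ((-1) ^ i * 1 ^ (j - i) * j.choose i) := fun i hi => by
      have hi' : i ≤ j := Nat.le_of_lt_succ (Finset.mem_range.mp hi)
      simp only [← mul_pow (_ : ℂ) ((starRingEnd ℂ) _) (j - i)]
      rw [integral_discUniform_beta, Nat.sub_add_cancel hi', Nat.factorial_succ]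
      have h2 : (j.choose i : ℂ) * i.factorial * (j - i).factorial = j.factorial := by
        exact_mod_cast Nat.choose_mul_factorial_mul_factorial hi'
      have h3 : (j.factorial : ℂ) ≠ 0 := by exact_mod_cast j.factorial_ne_zero
      have hp : (j : ℂ) + 1 ≠ 0 := by exact_mod_cast j.succ_ne_zero
      push_cast
      field_simp
      rw [one_pow, mul_one]
      linear_combination (j.choose i : ℂ) * h2
    rw [Finset.sum_congr rfl h1, ← Finset.mul_sum, ← add_pow]
    simp [show j ≠ 0 by omega]
  · refine Finset.sum_eq_zero fun i hi => ?_
    have hi' : i ≤ e := Nat.le_of_lt_succ (Finset.mem_range.mp hi)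
    by_cases hij : j < i
    · simp [Nat.choose_eq_zero_of_lt hij]
    have hne : ((j : ℂ) - e) ≠ 0 := sub_ne_zero.mpr (by exact_mod_cast hje)
    -- The rotation by `π / (j - e)` changes the sign of the integrand.
    set α : ℝ := Real.pi / ((j : ℝ) - e) with hα
    have h1 := integral_discUniform_rotate (fun z => z ^ (j - i) * (starRingEnd ℂ) z ^ (e - i)
      * (z * (starRingEnd ℂ) z - 1) ^ i) (Circle.exp α)
    have hu := conj_mul_self_of_norm_eq_one (Circle.norm_coe (Circle.exp α))
    have h3 : (Circle.exp α : ℂ) ^ (j - i) * (starRingEnd ℂ) (Circle.exp α : ℂ) ^ (e - i)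
        = -1 := by
      rw [Circle.coe_exp, ← Complex.exp_conj, ← Complex.exp_nat_mul, ← Complex.exp_nat_mul,
        ← Complex.exp_add, ← Complex.exp_pi_mul_I]
      congr 1
      rw [Nat.cast_sub hi', Nat.cast_sub (not_lt.mp hij)]
      simp only [map_mul, Complex.conj_ofReal, Complex.conj_I, hα]
      push_cast
      field_simp
      ring
    have h2 : ∀ z : ℂ, ((Circle.exp α : ℂ) * z) ^ (j - i)
        * (starRingEnd ℂ) ((Circle.exp α : ℂ) * z) ^ (e - i)
        * ((Circle.exp α : ℂ) * z * (starRingEnd ℂ) ((Circle.exp α : ℂ) * z) - 1) ^ i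
        = -(z ^ (j - i) * (starRingEnd ℂ) z ^ (e - i) * (z * (starRingEnd ℂ) z - 1) ^ i) :=
      fun z => by
        have h4 : (Circle.exp α : ℂ) * z * (starRingEnd ℂ) ((Circle.exp α : ℂ) * z)
            = z * (starRingEnd ℂ) z := by
          rw [map_mul]; linear_combination (z * (starRingEnd ℂ) z) * hu
        rw [h4, map_mul, mul_pow, mul_pow]
        linear_combination
          (z ^ (j - i) * (starRingEnd ℂ) z ^ (e - i) * (z * (starRingEnd ℂ) z - 1) ^ i) * h3
    simp only [h2] at h1
    rw [integral_neg] at h1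
    rw [show ∫ z, z ^ (j - i) * (starRingEnd ℂ) z ^ (e - i) * (z * (starRingEnd ℂ) z - 1) ^ i
      ∂discUniform = 0 by linear_combination (-1 / 2 : ℂ) * h1, mul_zero]

/-- The mean of `f` over the values of `normP k` on the circle tends to its mean over the disc. -/
def MeanConverges (f : ℂ → ℂ) : Prop :=
  Tendsto (fun k => ∫ z, f (normP k z) ∂circleUniform) atTop (𝓝 (∫ z, f z ∂discUniform))

theorem integrable_comp_normP {f : ℂ → ℂ} (hf : Continuous f) (k : ℕ) :
    Integrable (fun z => f (normP k z)) circleUniform :=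
  integrable_circleUniform (hf.comp (continuous_normP k))

theorem MeanConverges.const_mul {f : ℂ → ℂ} (h : MeanConverges f) (a : ℂ) :
    MeanConverges fun z => a * f z := by
  unfold MeanConverges
  simp only [integral_const_mul]
  exact Tendsto.const_mul a h

theorem MeanConverges.add {f g : ℂ → ℂ} (hf : MeanConverges f) (hg : MeanConverges g)
    (cf : Continuous f) (cg : Continuous g) : MeanConverges fun z => f z + g z := by
  unfold MeanConverges
  simp only [integral_add (integrable_comp_normP cf _) (integrable_comp_normP cg _),
    integral_add (integrable_discUniform cf) (integrable_discUniform cg)]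
  exact Tendsto.add hf hg

theorem MeanConverges.sub {f g : ℂ → ℂ} (hf : MeanConverges f) (hg : MeanConverges g)
    (cf : Continuous f) (cg : Continuous g) : MeanConverges fun z => f z - g z := by
  unfold MeanConverges
  simp only [integral_sub (integrable_comp_normP cf _) (integrable_comp_normP cg _),
    integral_sub (integrable_discUniform cf) (integrable_discUniform cg)]
  exact Tendsto.sub hf hg

theorem MeanConverges.sum {ι : Type*} (s : Finset ι) {f : ι → ℂ → ℂ}
    (hf : ∀ i ∈ s, MeanConverges (f i)) (cf : ∀ i ∈ s, Continuous (f i)) :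
    MeanConverges fun z => ∑ i ∈ s, f i z := by
  unfold MeanConverges
  simp only [integral_finsetSum s fun i hi => integrable_comp_normP (cf i hi) _,
    integral_finsetSum s fun i hi => integrable_discUniform (cf i hi)]
  exact tendsto_finsetSum s hf

theorem meanConverges_discPoly {j e : ℕ} (h : 1 ≤ j + e) : MeanConverges (discPoly j e) := by
  rw [MeanConverges, integral_discPoly h]
  exact tendsto_integral_discPoly h

/-- The leading monomial of `z ^ a * z̄ ^ b * (z * z̄ - 1) ^ i` is `z ^ (a + i) * z̄ ^ (b + i)`, and
convergence is assumed for all monomials of degree less than `n`. -/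
theorem MeanConverges.mul_sub_one_pow_sub {n : ℕ}
    (hn : ∀ a b, a + b < n → MeanConverges fun z => z ^ a * (starRingEnd ℂ) z ^ b) (i a b : ℕ)
    (hab : a + b + 2 * i ≤ n) :
    MeanConverges fun z => z ^ a * (starRingEnd ℂ) z ^ b * (z * (starRingEnd ℂ) z - 1) ^ i
      - z ^ (a + i) * (starRingEnd ℂ) z ^ (b + i) := by
  induction i generalizing a b with
  | zero => simp [MeanConverges]
  | succ i ih =>
    have h1 := ih (a + 1) (b + 1) (by omega)
    have h2 := (ih a b (by omega)).add (hn (a + i) (b + i) (by omega))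
      (by fun_prop) (by fun_prop)
    have h3 := h1.sub h2 (by fun_prop) (by fun_prop)
    convert h3 using 2
    ring

theorem meanConverges_monomial (j e : ℕ) :
    MeanConverges fun z => z ^ j * (starRingEnd ℂ) z ^ e := by
  induction h : j + e using Nat.strong_induction_on generalizing j e with
  | _ n ih =>
    subst h
    rcases Nat.eq_zero_or_pos (j + e) with h0 | h0
    · obtain ⟨rfl, rfl⟩ : j = 0 ∧ e = 0 := by omega
      simp [MeanConverges]
    have hn : ∀ a b, a + b < j + e → MeanConverges fun z => z ^ a * (starRingEnd ℂ) z ^ b :=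
      fun a b hab => ih _ hab a b rfl
    -- Modulo lower degree, `discPoly j e` is a positive multiple of the monomial.
    have h1 : MeanConverges fun z => ∑ i ∈ Finset.range (e + 1),
        (j.choose i : ℂ) * e.choose i *
          (z ^ (j - i) * (starRingEnd ℂ) z ^ (e - i) * (z * (starRingEnd ℂ) z - 1) ^ i
            - z ^ j * (starRingEnd ℂ) z ^ e) := by
      refine MeanConverges.sum _ (fun i hi => ?_) (fun i _ => by fun_prop)
      have hi' : i ≤ e := Nat.le_of_lt_succ (Finset.mem_range.mp hi)
      by_cases hij : j < i
      · simp [Nat.choose_eq_zero_of_lt hij, MeanConverges]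
      · have := MeanConverges.mul_sub_one_pow_sub hn i (j - i) (e - i) (by omega)
        rw [Nat.sub_add_cancel (not_lt.mp hij), Nat.sub_add_cancel hi'] at this
        exact this.const_mul _
    have h2 := (meanConverges_discPoly h0).sub h1 (continuous_discPoly j e) (by fun_prop)
    set S : ℂ := ∑ i ∈ Finset.range (e + 1), (j.choose i : ℂ) * e.choose i with hS
    have hS0 : S ≠ 0 := by
      have : S = ((∑ i ∈ Finset.range (e + 1), j.choose i * e.choose i : ℕ) : ℂ) := by
        rw [hS]; push_cast; rfl
      rw [this]
      have h3 : 0 < ∑ i ∈ Finset.range (e + 1), j.choose i * e.choose i :=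
        Finset.sum_pos' (fun _ _ => Nat.zero_le _) ⟨0, by simp, by simp⟩
      exact_mod_cast h3.ne'
    have h4 := h2.const_mul S⁻¹
    convert h4 using 2 with z
    simp only [discPoly]
    rw [← Finset.sum_sub_distrib]
    simp only [← mul_sub, sub_sub_cancel]
    rw [← Finset.sum_mul, ← hS, inv_mul_cancel_left₀ hS0]

/-! ### Weak convergence -/

/-- Stone-Weierstrass: polynomials in `z` and `z̄` are dense in the continuous functions on the
closed disc. -/
theorem exists_meanConverges_approx {f : ℂ → ℂ} (hf : Continuous f) {ε : ℝ} (hε : 0 < ε) :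
    ∃ p : ℂ → ℂ, Continuous p ∧ MeanConverges p ∧ ∀ z, ‖z‖ ≤ 1 → ‖f z - p z‖ < ε := by
  let K : Set ℂ := Metric.closedBall (0 : ℂ) 1
  have : CompactSpace K := isCompact_iff_compactSpace.mp (isCompact_closedBall 0 1)
  let g : C(K, ℂ) := ⟨fun z => f z, hf.comp continuous_subtype_val⟩
  have hg : g ∈ (polynomialFunctions K).starClosure.topologicalClosure := by
    rw [polynomialFunctions.starClosure_topologicalClosure]; trivial
  rw [← SetLike.mem_coe, StarSubalgebra.topologicalClosure_coe, Metric.mem_closure_iff] at hg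
  obtain ⟨q, hq, hgq⟩ := hg ε hε
  suffices h : ∃ p : ℂ → ℂ, Continuous p ∧ MeanConverges p ∧ ∀ z : K, q z = p z by
    obtain ⟨p, hp1, hp2, hp3⟩ := h
    refine ⟨p, hp1, hp2, fun z hz => ?_⟩
    have hzK : z ∈ K := by simpa [K] using hz
    have h1 := (ContinuousMap.dist_apply_le_dist (f := g) (g := q) ⟨z, hzK⟩).trans_lt hgq
    rw [hp3, dist_eq_norm] at h1
    exact h1
  rw [polynomialFunctions.starClosure_eq_adjoin_X, SetLike.mem_coe,
    ← StarSubalgebra.mem_toSubalgebra, StarAlgebra.adjoin_toSubalgebra,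
    ← Subalgebra.mem_toSubmodule, Algebra.adjoin_eq_span] at hq
  clear hgq
  induction hq using Submodule.span_induction with
  | mem q hq =>
    rw [Set.star_singleton, Set.singleton_union, SetLike.mem_coe,
      Submonoid.mem_closure_pair] at hq
    obtain ⟨a, b, rfl⟩ := hq
    exact ⟨fun z => z ^ a * (starRingEnd ℂ) z ^ b, by fun_prop, meanConverges_monomial a b,
      fun z => by simp⟩
  | zero => exact ⟨fun _ => 0, continuous_const, by simp [MeanConverges], fun z => rfl⟩
  | add q₁ q₂ _ _ h₁ h₂ =>
    obtain ⟨p₁, c₁, m₁, e₁⟩ := h₁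
    obtain ⟨p₂, c₂, m₂, e₂⟩ := h₂
    exact ⟨fun z => p₁ z + p₂ z, by fun_prop, m₁.add m₂ c₁ c₂, fun z => by
      rw [ContinuousMap.add_apply, e₁, e₂]⟩
  | smul a q _ h =>
    obtain ⟨p, c, m, e⟩ := h
    exact ⟨fun z => a * p z, by fun_prop, m.const_mul a, fun z => by
      rw [ContinuousMap.smul_apply, e, smul_eq_mul]⟩

theorem meanConverges_of_continuous {f : ℂ → ℂ} (hf : Continuous f) : MeanConverges f := by
  rw [MeanConverges, Metric.tendsto_atTop]
  intro ε hε
  obtain ⟨p, hp, hpm, hfp⟩ := exists_meanConverges_approx hf (ε := ε / 3) (by positivity)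
  rw [MeanConverges, Metric.tendsto_atTop] at hpm
  obtain ⟨k₀, hk₀⟩ := hpm (ε / 3) (by positivity)
  refine ⟨k₀, fun k hk => ?_⟩
  have h1 : dist (∫ z, f (normP k z) ∂circleUniform) (∫ z, p (normP k z) ∂circleUniform)
      ≤ ε / 3 := by
    rw [dist_eq_norm, ← integral_sub (integrable_comp_normP hf k) (integrable_comp_normP hp k)]
    refine (norm_integral_le_of_norm_le_const (C := ε / 3) ?_).trans (by simp)
    filter_upwards [ae_norm_eq_one_circleUniform] with z hz
    exact (hfp _ (norm_normP_le_one k hz)).le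
  have h2 : dist (∫ z, p z ∂discUniform) (∫ z, f z ∂discUniform) ≤ ε / 3 := by
    rw [dist_comm, dist_eq_norm,
      ← integral_sub (integrable_discUniform hf) (integrable_discUniform hp)]
    refine (norm_integral_le_of_norm_le_const (C := ε / 3) ?_).trans (by simp)
    filter_upwards [ae_norm_le_one_discUniform] with z hz
    exact (hfp z hz).le
  have h3 := hk₀ k hk
  have h4 := dist_triangle4 (∫ z, f (normP k z) ∂circleUniform)
    (∫ z, p (normP k z) ∂circleUniform) (∫ z, p z ∂discUniform) (∫ z, f z ∂discUniform)
  linarith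

/-- The law of `P k / √(2 ^ (k + 1))` at a uniform random point of the unit circle. -/
noncomputable def lawP (k : ℕ) : ProbabilityMeasure ℂ :=
  ⟨circleUniform.map (normP k),
    Measure.isProbabilityMeasure_map (continuous_normP k).aemeasurable⟩

/-- `discUniform` as a point of the space of probability measures. -/
noncomputable def discLaw : ProbabilityMeasure ℂ := ⟨discUniform, inferInstance⟩

theorem tendsto_lawP : Tendsto lawP atTop (𝓝 discLaw) := by
  rw [ProbabilityMeasure.tendsto_iff_forall_integral_rclike_tendsto ℂ]
  intro f
  refine (meanConverges_of_continuous f.continuous).congr fun k => ?_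
  exact (integral_map (continuous_normP k).aemeasurable
    f.continuous.aestronglyMeasurable).symm

theorem IsRectangle.convex {E : Set ℂ} (hE : IsRectangle E) : Convex ℝ E := by
  obtain ⟨u, I, J, -, hI, hJ, rfl⟩ := hE
  have h1 : Convex ℝ (I ×ℂ J) :=
    (hI.convex.linear_preimage Complex.reLm).inter (hJ.convex.linear_preimage Complex.imLm)
  exact h1.linear_image (LinearMap.mulLeft ℝ u)

theorem IsRectangle.measurableSet {E : Set ℂ} (hE : IsRectangle E) : MeasurableSet E := by
  obtain ⟨u, I, J, hu, hI, hJ, rfl⟩ := hE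
  have hu0 : u ≠ 0 := fun h => by simp [h] at hu
  have h1 : MeasurableSet (I ×ℂ J) :=
    (Complex.measurable_re hI.measurableSet).inter (Complex.measurable_im hJ.measurableSet)
  exact (measurableEmbedding_mulLeft₀ hu0).measurableSet_image.mpr h1

end RudinShapiro

theorem theorem2 {Ω : Type*} [MeasurableSpace Ω] (μ : Measure Ω) [IsProbabilityMeasure μ]
    (ω : Ω → ℂ) (hω : HasLaw ω RudinShapiro.circleUniform μ)
    (E : Set ℂ) (hE : RudinShapiro.IsRectangle E) (hED : E ⊆ Metric.closedBall (0 : ℂ) 1) :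
    Tendsto
      (fun k : ℕ => μ.real
        {x | (RudinShapiro.P k).eval (ω x) / ((Real.sqrt (2 ^ (k + 1)) : ℝ) : ℂ) ∈ E})
      atTop (𝓝 (volume.real E / Real.pi)) := by
  have hfr : RudinShapiro.discUniform (frontier E) = 0 :=
    (cond_absolutelyContinuous (μ := volume)) (hE.convex.addHaar_frontier volume)
  have h1 := ProbabilityMeasure.tendsto_measure_of_null_frontier_of_tendsto'
    RudinShapiro.tendsto_lawP (E := E) hfr
  have h2 := (ENNReal.tendsto_toReal (measure_ne_top (RudinShapiro.discLaw : Measure ℂ) E)).comp h1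
  have h3 : (RudinShapiro.discUniform E).toReal = volume.real E / Real.pi := by
    rw [RudinShapiro.discUniform, cond_apply Metric.isClosed_closedBall.measurableSet,
      Set.inter_eq_right.mpr hED, RudinShapiro.volume_unit_closedBall, ENNReal.toReal_mul,
      ENNReal.toReal_inv, ENNReal.toReal_ofReal Real.pi_pos.le, Measure.real]
    ring
  rw [← h3]
  refine h2.congr fun k => ?_
  have hm := RudinShapiro.continuous_normP k
  change ((RudinShapiro.circleUniform.map (RudinShapiro.normP k)) E).toReal
    = μ.real {x | RudinShapiro.normP k (ω x) ∈ E}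
  rw [Measure.map_apply hm.measurable hE.measurableSet,
    hω.measureReal_eq (p := fun z => RudinShapiro.normP k z ∈ E)
      (hm.measurable hE.measurableSet)]
  rfl
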